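/- Let $P=(P(i,j))_{i,j\in E}$ be the transition matrix of an irreducible, positive recurrent discrete-time Markov chain $\Phi=\{\Phi_k,k\ge 0\}$ on a countable state space $E$, with invariant probability vector $\boldsymbol\pi$ ($\boldsymbol\pi^TP=\boldsymbol\pi^T$, $\boldsymbol\pi^T\boldsymbol e=1$, $\boldsymbol e$ the column vector of ones). Let $A$ be a finite non-empty subset of $E$, let $B=E\setminus A$, and partition $P$ into the blocks $P_{AA},P_{AB},P_{BA},P_{BB}$. Put $\widehat P_{BB}=\sum_{k\ge 0}P_{BB}^k$ and let $P^{(A)}=P_{AA}+P_{AB}\widehat P_{BB}P_{BA}$, the transition matrix of the chain censored on $A$, that is, $P^{(A)}(i,j)=\mathbb P_i(\tau_A<\infty,\ \Phi_{\tau_A}=j)$ for $i,j\in A$, where $\tau_A=\inf\{k\ge1:\Phi_k\in A\}$. For a finite square matrix $W$, the group inverse $W^\#$ is the unique matrix (if there is one) with $WW^\#W=W$, $W^\#WW^\#=W^\#$ and $W^\#W=WW^\#$. Then all entries of $\widehat P_{BB}$ and of the matrix products below are convergent sums, the group inverse $(I-P^{(A)})^\#$ exists, and the matrix $\widetilde X=(\widetilde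 X(i,j))_{i,j\in E}$ with row blocks \[ \widetilde X_A=\left(I-P^{(A)}\right)^{\#}\left(\left[I,\;P_{AB}\widehat P_{BB}\right]-\left(\boldsymbol e+P_{AB}\widehat P_{BB}\boldsymbol e\right)\boldsymbol\pi^T\right), \] \[ \widetilde X_B=\widehat P_{BB}P_{BA}\widetilde X_A+\left[O,\;\widehat P_{BB}\right]-\widehat P_{BB}\boldsymbol e\,\boldsymbol\pi^T \] is a solution of Poisson's equation \[ (I-P)X=I-\boldsymbol e\boldsymbol\pi^T . \] Moreover, if $\mathbb E_{\boldsymbol\pi}[\tau_i]<\infty$ for some $i\in E$, where $\tau_i=\inf\{k\ge 1:\Phi_k=i\}$, then $\widetilde X$ is, up to adding a matrix $\boldsymbol e\boldsymbol\beta^T$, the unique solution of Poisson's equation among the matrices $X$ with $\boldsymbol\pi^T|X|<\infty$ (that is, $\sum_{i\in E}\pi(i)|X(i,j)|<\infty$ for every $j\in E$): the solutions $X$ with $\boldsymbol\pi^T|X|<\infty$ are exactly the matrices $\widetilde X+\boldsymbol e\boldsymbol\beta^T$ with $\boldsymbol\beta\in\mathbb R^E$. -/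

import Mathlib

open MeasureTheory Matrix
open scoped ENNReal

noncomputable section

namespace PoissonMC

/-! ### Matrices with arbitrary index sets -/

/-- Product of two matrices whose inner index set may be infinite. -/
def infMul {l m n : Type*} (M : Matrix l m ℝ) (N : Matrix m n ℝ) : Matrix l n ℝ :=
  Matrix.of fun i j => ∑' k, M i k * N k j

/-- All entries of the product of `M` and `N` are (absolutely) convergent sums. -/
def MulConverges {l m n : Type*} (M : Matrix l m ℝ) (N : Matrix m n ℝ) : Prop :=
  ∀ i j, Summable fun k => M i k * N k j

/-- Product of a possibly infinite matrix and a column vector. -/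
def infMulVec {l m : Type*} (M : Matrix l m ℝ) (v : m → ℝ) : l → ℝ :=
  fun i => ∑' k, M i k * v k

/-- All entries of the matrix-vector product are (absolutely) convergent sums. -/
def MulVecConverges {l m : Type*} (M : Matrix l m ℝ) (v : m → ℝ) : Prop :=
  ∀ i, Summable fun k => M i k * v k

/-- Powers of a possibly infinite square matrix. -/
def infPow {m : Type*} [DecidableEq m] (M : Matrix m m ℝ) : ℕ → Matrix m m ℝ
  | 0 => 1
  | k + 1 => infMul M (infPow M k)

/-! ### The group inverse of a finite square matrix -/

/-- `G` is a group inverse of the finite square matrix `W`. -/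
structure IsGroupInverse {m : Type*} [Fintype m] (W G : Matrix m m ℝ) : Prop where
  mul_mul_self : W * G * W = W
  mul_self_mul : G * W * G = G
  comm : G * W = W * G

/-- A matrix has at most one group inverse. -/
theorem IsGroupInverse.unique {m : Type*} [Fintype m] {W G H : Matrix m m ℝ}
    (hG : IsGroupInverse W G) (hH : IsGroupInverse W H) : G = H := by
  have h1 : G * W = H * W := by
    calc G * W = W * G := hG.comm
      _ = W * H * W * G := by rw [hH.mul_mul_self]
      _ = H * W * W * G := by rw [hH.comm]
      _ = H * W * (W * G) := by simp only [Matrix.mul_assoc]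
      _ = H * W * (G * W) := by rw [hG.comm]
      _ = H * (W * G * W) := by simp only [Matrix.mul_assoc]
      _ = H * W := by rw [hG.mul_mul_self]
  calc G = G * W * G := hG.mul_self_mul.symm
    _ = H * W * G := by rw [h1]
    _ = H * (W * G) := by rw [Matrix.mul_assoc]
    _ = H * (G * W) := by rw [hG.comm]
    _ = H * (H * W) := by rw [h1]
    _ = H * (W * H) := by rw [hH.comm]
    _ = H * W * H := by rw [Matrix.mul_assoc]
    _ = H := hH.mul_self_mul

open scoped Classical in
/-- The group inverse `W^#`; it is only meaningful when a group inverse exists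
(otherwise it is `0`). -/
def groupInverse {m : Type*} [Fintype m] (W : Matrix m m ℝ) : Matrix m m ℝ :=
  if h : ∃ G, IsGroupInverse W G then h.choose else 0

/-! ### Markov chains -/

/-- `P` is a stochastic (transition) matrix. -/
structure IsStochastic {E : Type*} (P : Matrix E E ℝ) : Prop where
  nonneg : ∀ i j, 0 ≤ P i j
  hasSum_row : ∀ i, HasSum (fun j => P i j) 1

/-- `π` is an invariant probability vector of `P`. -/
structure IsInvariantProb {E : Type*} (P : Matrix E E ℝ) (π : E → ℝ) : Prop where
  nonneg : ∀ i, 0 ≤ π i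
  hasSum_one : HasSum π 1
  invariant : ∀ j, HasSum (fun i => π i * P i j) (π j)

/-- `Φ` is a (time-homogeneous) Markov chain on the countable set `E` with transition matrix `P`,
where `ℙ i` is the probability measure under which the chain starts at `i`. -/
structure IsMarkovChain {E Ω : Type*} [DecidableEq E] [MeasurableSpace Ω]
    (P : Matrix E E ℝ) (ℙ : E → Measure Ω) (Φ : ℕ → Ω → E) : Prop where
  isProbabilityMeasure : ∀ i, IsProbabilityMeasure (ℙ i)
  measurable : ∀ n, Measurable[inferInstance, ⊤] (Φ n)
  finite_dim : ∀ (i : E) (n : ℕ) (x : ℕ → E),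
    ℙ i {ω | ∀ k ≤ n, Φ k ω = x k} =
      ENNReal.ofReal ((if x 0 = i then 1 else 0) * ∏ k ∈ Finset.range n, P (x k) (x (k + 1)))

/-- First return time `inf {k ≥ 1 : Φ k ∈ S}`, with value `⊤` if there is no such `k`. -/
def returnTime {E Ω : Type*} (Φ : ℕ → Ω → E) (S : Set E) : Ω → ℕ∞ :=
  hittingAfter Φ S 1

/-- The expectation of the first return time to `S` under the measure `μ`. -/
def expectedReturnTime {E Ω : Type*} [MeasurableSpace Ω] (μ : Measure Ω) (Φ : ℕ → Ω → E)
    (S : Set E) : ℝ≥0∞ :=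
  ∫⁻ ω, (returnTime Φ S ω : ℝ≥0∞) ∂μ

/-- All mean return times `E_i[τ_i]` are finite. -/
def PositiveRecurrent {E Ω : Type*} [MeasurableSpace Ω] (ℙ : E → Measure Ω)
    (Φ : ℕ → Ω → E) : Prop :=
  ∀ i, expectedReturnTime (ℙ i) Φ {i} < ∞

/-- The law under which the initial state has distribution `π`. -/
def lawFrom {E Ω : Type*} [MeasurableSpace Ω] (ℙ : E → Measure Ω) (π : E → ℝ) : Measure Ω :=
  Measure.sum fun i => ENNReal.ofReal (π i) • ℙ i

/-! ### Blocks, the censored chain and the matrix `X̃` -/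

section Blocks

variable {E : Type*} [DecidableEq E] (P : Matrix E E ℝ) (π : E → ℝ) (A : Finset E)

/-- The block `P_AA`. -/
def blockAA : Matrix {i // i ∈ A} {i // i ∈ A} ℝ := P.toBlock (· ∈ A) (· ∈ A)

/-- The block `P_AB`, with `B` the complement of `A`. -/
def blockAB : Matrix {i // i ∈ A} {i // i ∉ A} ℝ := P.toBlock (· ∈ A) (· ∉ A)

/-- The block `P_BA`. -/
def blockBA : Matrix {i // i ∉ A} {i // i ∈ A} ℝ := P.toBlock (· ∉ A) (· ∈ A)

/-- The block `P_BB`. -/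
def blockBB : Matrix {i // i ∉ A} {i // i ∉ A} ℝ := P.toBlock (· ∉ A) (· ∉ A)

/-- `P̂_BB = ∑ₖ P_BB ^ k`. -/
def hatBB : Matrix {i // i ∉ A} {i // i ∉ A} ℝ :=
  Matrix.of fun i j => ∑' k, infPow (blockBB P A) k i j

/-- `P_AB P̂_BB`. -/
def blockABhat : Matrix {i // i ∈ A} {i // i ∉ A} ℝ := infMul (blockAB P A) (hatBB P A)

/-- `P̂_BB P_BA`. -/
def hatBlockBA : Matrix {i // i ∉ A} {i // i ∈ A} ℝ := infMul (hatBB P A) (blockBA P A)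

/-- `P^(A) = P_AA + P_AB P̂_BB P_BA`, the transition matrix of the chain censored on `A`. -/
def censored : Matrix {i // i ∈ A} {i // i ∈ A} ℝ :=
  blockAA P A + infMul (blockABhat P A) (blockBA P A)

/-- The matrix `[M, N]` with columns indexed by `E = A ∪ B`. -/
def glueCols {l : Type*} (M : Matrix l {i // i ∈ A} ℝ) (N : Matrix l {i // i ∉ A} ℝ) :
    Matrix l E ℝ :=
  Matrix.of fun i j => if h : j ∈ A then M i ⟨j, h⟩ else N i ⟨j, h⟩

/-- The rows of `X̃` in `A`:
`(I - P^(A))^# ([I, P_AB P̂_BB] - (e + P_AB P̂_BB e) πᵀ)`. -/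
def XtildeA : Matrix {i // i ∈ A} E ℝ :=
  groupInverse (1 - censored P A) *
    (glueCols A 1 (blockABhat P A) - vecMulVec (1 + infMulVec (blockABhat P A) 1) π)

/-- The rows of `X̃` in `B`: `P̂_BB P_BA X̃_A + [O, P̂_BB] - P̂_BB e πᵀ`. -/
def XtildeB : Matrix {i // i ∉ A} E ℝ :=
  hatBlockBA P A * XtildeA P π A + glueCols A 0 (hatBB P A) -
    vecMulVec (infMulVec (hatBB P A) 1) π

/-- The matrix `X̃` with row blocks `X̃_A` and `X̃_B`. -/
def Xtilde : Matrix E E ℝ :=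
  Matrix.of fun i j => if h : i ∈ A then XtildeA P π A ⟨i, h⟩ j else XtildeB P π A ⟨i, h⟩ j

/-- All the infinite sums that occur in the definitions of `P^(A)` and `X̃` converge. -/
structure BlocksConverge : Prop where
  pow : ∀ k, MulConverges (blockBB P A) (infPow (blockBB P A) k)
  hat : ∀ i j, Summable fun k => infPow (blockBB P A) k i j
  AB_hat : MulConverges (blockAB P A) (hatBB P A)
  hat_BA : MulConverges (hatBB P A) (blockBA P A)
  AB_hat_BA : MulConverges (blockABhat P A) (blockBA P A)
  hat_one : MulVecConverges (hatBB P A) 1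
  AB_hat_one : MulVecConverges (blockABhat P A) 1

/-- `X` solves `(I - P) X = I - e πᵀ`, the product on the left being convergent. -/
def IsPoissonSolution (X : Matrix E E ℝ) : Prop :=
  MulConverges (1 - P) X ∧ infMul (1 - P) X = 1 - vecMulVec 1 π

end Blocks

/-- `πᵀ |X| < ∞`, entry by entry. -/
def PiAbsFinite {E : Type*} (π : E → ℝ) (X : Matrix E E ℝ) : Prop :=
  ∀ j, Summable fun i => π i * |X i j|

end PoissonMC

end

/-! Everything is expressed through one potential: `green p A g x` is the expectation, started at
`x`, of the sum of `g` over the times `0, …, τ_A - 1`. The choices `g = 1_j`, `g = P(·, a)` and `g =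
1` give the entries of `P̂_BB` and `P_AB P̂_BB`, the return law on `A` (hence `P^(A)` and `P̂_BB
P_BA`), and the mean return time. In `ℝ≥0∞` all rearrangements are free; real sums follow once
`green_one_ne_top` gives finiteness.

Two identities carry the existence part: the first-step equation `green_eq`, and the cycle formula
`sum_mul_green_eq`, which recovers `∑ π g` over `E` from the potential of `g` on `A` weighted by
`π`. By the maximum principle the kernel of `W = I - P^(A)` is the constants, and `π` restricted to
`A` is a left null vector. Hence `W^#` exists and `W W^# = I - e νᵀ`, with `ν` the normalised
restriction of `π`. The cycle formula says that `ν` kills the right-hand factor of `X̃_A`, so `W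
X̃_A` is that factor. Therefore (`Xtilde_apply`), for every `x` in `E`, `X̃(x, j)` is the mean of
`X̃(·, j)` at the return to `A`, plus the mean number of visits to `j` before it, minus `π(j)
E_x[τ_A]`. First-step analysis of these three terms is Poisson's equation.

For uniqueness, two solutions differ columnwise by a `π`-integrable harmonic function, which is
constant (`apply_le_of_harmonic_of_summable`). That `X̃` is `π`-integrable follows from `E_x[τ_A] ≤
E_x[τ_i] + E_i[τ_A]`. -/

noncomputable section

namespace PoissonMC

open Filter Topology

/-! ### Potential theory of the kernel killed on `A`, in `ℝ≥0∞`. -/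

section Taboo

variable {E : Type*}

/-- One step of the kernel `p` restricted to targets outside `A`, acting on functions. -/
def tabooStep (p : E → E → ℝ≥0∞) (A : Finset E) (g : E → ℝ≥0∞) : E → ℝ≥0∞ :=
  fun x => ∑' b : {b // b ∉ A}, p x b * g b

/-- The Green potential of `g` for the kernel `p` restricted to targets outside `A`. -/
def green (p : E → E → ℝ≥0∞) (A : Finset E) (g : E → ℝ≥0∞) : E → ℝ≥0∞ :=
  fun x => ∑' n : ℕ, (tabooStep p A)^[n] g x

theorem sum_mem_add_tsum_notMem (A : Finset E) (f : E → ℝ≥0∞) :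
    ∑ a : {a // a ∈ A}, f a + ∑' b : {b // b ∉ A}, f b = ∑' x, f x := by
  rw [← ENNReal.sum_add_tsum_compl A f, Finset.sum_coe_sort A f]
  rfl

variable {p : E → E → ℝ≥0∞} {A : Finset E} {g h : E → ℝ≥0∞}

theorem tabooStep_mono : Monotone (tabooStep p A) := fun _ _ hgh x =>
  ENNReal.tsum_le_tsum fun b => by gcongr; exact hgh b

theorem iterate_tabooStep_mono (n : ℕ) (hgh : g ≤ h) :
    (tabooStep p A)^[n] g ≤ (tabooStep p A)^[n] h :=
  tabooStep_mono.iterate n hgh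

theorem tabooStep_add : tabooStep p A (g + h) = tabooStep p A g + tabooStep p A h := by
  ext x
  simp [tabooStep, mul_add, ENNReal.tsum_add]

theorem iterate_tabooStep_add (n : ℕ) :
    (tabooStep p A)^[n] (g + h) = (tabooStep p A)^[n] g + (tabooStep p A)^[n] h := by
  induction n with
  | zero => rfl
  | succ n ih => simp only [Function.iterate_succ_apply', ih, tabooStep_add]

theorem green_mono (hgh : g ≤ h) : green p A g ≤ green p A h := fun x =>
  ENNReal.tsum_le_tsum fun n => iterate_tabooStep_mono n hgh x

theorem green_sum {ι : Type*} (s : Finset ι) (f : ι → E → ℝ≥0∞) (x : E) :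
    green p A (∑ i ∈ s, f i) x = ∑ i ∈ s, green p A (f i) x := by
  classical
  induction s using Finset.induction_on with
  | empty =>
    have : ∀ n, (tabooStep p A)^[n] 0 = 0 := fun n => by
      induction n with
      | zero => rfl
      | succ n ih => rw [Function.iterate_succ_apply', ih]; ext; simp [tabooStep]
    simp [green, this]
  | insert i s hi ih =>
    rw [Finset.sum_insert hi, Finset.sum_insert hi, ← ih]
    simp [green, iterate_tabooStep_add, ENNReal.tsum_add]

theorem green_eq (x : E) :
    green p A g x = g x + ∑' b : {b // b ∉ A}, p x b * green p A g b := by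
  rw [green, tsum_eq_zero_add' ENNReal.summable]
  simp only [Function.iterate_zero, id, Function.iterate_succ_apply']
  congr 1
  simp only [tabooStep, green, ← ENNReal.tsum_mul_left]
  exact ENNReal.tsum_comm

/-- Started outside `A`, the killed chain sees `g` only outside `A`, so the potential is an integral
against its Green kernel. From a point of `A` the time-zero value must be added separately, as in
`green_apply_eq_add_tsum`. -/
theorem green_apply_eq_tsum (x : {b // b ∉ A}) [DecidableEq E] :
    green p A g x = ∑' j : {b // b ∉ A}, green p A (Pi.single j.1 1) x * g j := by
  have key : ∀ (n : ℕ) (x : {b // b ∉ A}), (tabooStep p A)^[n] g x =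
      ∑' j : {b // b ∉ A}, (tabooStep p A)^[n] (Pi.single j.1 1) x * g j := by
    intro n
    induction n with
    | zero =>
      intro x
      rw [tsum_eq_single x]
      · simp
      · intro j hj
        have : x.1 ≠ j.1 := fun h => hj (Subtype.ext h.symm)
        simp [this]
    | succ n ih =>
      intro x
      simp only [Function.iterate_succ_apply', tabooStep, ih, ← ENNReal.tsum_mul_left,
        ← ENNReal.tsum_mul_right]
      rw [ENNReal.tsum_comm]
      simp only [mul_assoc]
  simp only [green, key, ← ENNReal.tsum_mul_right]
  exact ENNReal.tsum_comm

theorem green_apply_eq_add_tsum {x : E} (hx : x ∈ A) [DecidableEq E] :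
    green p A g x = g x + ∑' j : {b // b ∉ A}, green p A (Pi.single j.1 1) x * g j := by
  have hsingle : ∀ j : {b // b ∉ A}, green p A (Pi.single j.1 1) x =
      ∑' b : {b // b ∉ A}, p x b * green p A (Pi.single j.1 1) b := by
    intro j
    have : x ≠ j.1 := fun h => j.2 (h ▸ hx)
    rw [green_eq]
    simp [this]
  rw [green_eq]
  congr 1
  simp only [hsingle, ← ENNReal.tsum_mul_right]
  rw [ENNReal.tsum_comm]
  refine tsum_congr fun b => ?_
  rw [green_apply_eq_tsum b, ← ENNReal.tsum_mul_left]
  simp only [mul_assoc]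

variable (hp : ∀ x, ∑' y, p x y = 1)

include hp in
theorem tabooStep_le_one (hg : g ≤ 1) : tabooStep p A g ≤ 1 := fun x => by
  calc tabooStep p A g x ≤ ∑' b : {b // b ∉ A}, p x b :=
        ENNReal.tsum_le_tsum fun b => by
          simpa using mul_le_mul_right (hg b) (p x b)
    _ ≤ ∑' y, p x y := ENNReal.tsum_comp_le_tsum_of_injective Subtype.val_injective _
    _ = 1 := hp x

include hp in
theorem iterate_tabooStep_le_one (hg : g ≤ 1) (n : ℕ) : (tabooStep p A)^[n] g ≤ 1 := by
  induction n with
  | zero => exact hg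
  | succ n ih => rw [Function.iterate_succ_apply']; exact tabooStep_le_one hp ih

-- Split `1` into the probability of entering `A` at the next step and that of staying outside.
-- Summing over time telescopes; a finite mean return time is what allows the common tail to be
-- cancelled.
include hp in
theorem green_hitting_eq_one {x : E} (hx : green p A 1 x ≠ ∞) :
    green p A (∑ a : {a // a ∈ A}, fun y => p y a) x = 1 := by
  have hone : (1 : E → ℝ≥0∞) = (∑ a : {a // a ∈ A}, fun y => p y a) + tabooStep p A 1 := by
    ext y
    simp only [tabooStep, Pi.add_apply, Finset.sum_apply, Pi.one_apply, mul_one]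
    rw [sum_mem_add_tsum_notMem, hp]
  have hsplit : green p A 1 x =
      1 + ∑' n : ℕ, (tabooStep p A)^[n] (tabooStep p A 1) x := by
    rw [green, tsum_eq_zero_add' ENNReal.summable]
    rfl
  have hfin : ∑' n : ℕ, (tabooStep p A)^[n] (tabooStep p A 1) x ≠ ∞ := by
    rw [hsplit] at hx
    exact (ENNReal.add_ne_top.1 hx).2
  have hsplit' : green p A 1 x = green p A (∑ a : {a // a ∈ A}, fun y => p y a) x +
      ∑' n : ℕ, (tabooStep p A)^[n] (tabooStep p A 1) x := by
    conv_lhs => rw [hone]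
    simp [green, iterate_tabooStep_add, ENNReal.tsum_add]
  rw [hsplit] at hsplit'
  exact ((ENNReal.add_left_inj hfin).1 hsplit').symm

variable {q : E → ℝ≥0∞} (hq : ∀ j, ∑' i, q i * p i j = q j)

include hq in
theorem sum_tabooStep_add_tsum_tabooStep (f : E → ℝ≥0∞) :
    ∑ a : {a // a ∈ A}, q a * tabooStep p A f a +
      ∑' b : {b // b ∉ A}, q b * tabooStep p A f b = ∑' b : {b // b ∉ A}, q b * f b := by
  rw [sum_mem_add_tsum_notMem A fun x => q x * tabooStep p A f x]
  simp only [tabooStep, ← ENNReal.tsum_mul_left]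
  rw [ENNReal.tsum_comm]
  refine tsum_congr fun b => ?_
  rw [← hq b, ← ENNReal.tsum_mul_right]
  simp only [mul_assoc]

-- Mass balance: the `q`-mass of `g` outside `A` is either collected on `A` within `n` steps or
-- still carried by the `n`-th iterate. The remainder is dropped for `sum_mul_green_le` and shown to
-- vanish for `sum_mul_green_eq`.
include hq in
theorem sum_range_iterate_tabooStep_add (n : ℕ) :
    ∑ k ∈ Finset.range n, ∑ a : {a // a ∈ A}, q a * (tabooStep p A)^[k + 1] g a +
      ∑' b : {b // b ∉ A}, q b * (tabooStep p A)^[n] g b = ∑' b : {b // b ∉ A}, q b * g b := by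
  induction n with
  | zero => simp
  | succ n ih =>
    rw [← ih, ← sum_tabooStep_add_tsum_tabooStep hq ((tabooStep p A)^[n] g),
      Finset.sum_range_succ, add_assoc]
    simp only [Function.iterate_succ_apply']

theorem sum_mul_green (x : E → ℝ≥0∞) :
    ∑ a : {a // a ∈ A}, x a * green p A g a = ∑ a : {a // a ∈ A}, x a * g a +
      ∑' k : ℕ, ∑ a : {a // a ∈ A}, x a * (tabooStep p A)^[k + 1] g a := by
  simp only [green, ← ENNReal.tsum_mul_left]
  rw [← Summable.tsum_finsetSum fun _ _ => ENNReal.summable,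
    tsum_eq_zero_add' ENNReal.summable]
  rfl

include hq in
theorem sum_mul_green_le :
    ∑ a : {a // a ∈ A}, q a * green p A g a ≤ ∑' x, q x * g x := by
  rw [sum_mul_green, ← sum_mem_add_tsum_notMem A]
  gcongr
  refine ENNReal.tsum_le_of_sum_range_le fun n => ?_
  rw [← sum_range_iterate_tabooStep_add hq n]
  exact le_self_add

include hp hq in
/-- The invariant vector is recovered from the taboo Green potential on `A`. -/
theorem sum_mul_green_eq (hq1 : ∑' i, q i ≠ ∞) (hg : g ≤ 1) (hfin : ∀ x, green p A 1 x ≠ ∞) :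
    ∑ a : {a // a ∈ A}, q a * green p A g a = ∑' x, q x * g x := by
  -- Dominated convergence for counting measure, with dominating function `q`; each iterate tends to
  -- `0` pointwise as the general term of a convergent series.
  have hlim : Tendsto (fun n => ∑' b : {b // b ∉ A}, q b * (tabooStep p A)^[n] g b)
      atTop (𝓝 0) := by
    let _ : MeasurableSpace {b // b ∉ A} := ⊤
    have : MeasurableSingletonClass {b // b ∉ A} := ⟨fun _ => trivial⟩
    have := tendsto_lintegral_of_dominated_convergence (μ := Measure.count)
      (F := fun n (b : {b // b ∉ A}) => q b * (tabooStep p A)^[n] g b) (f := fun _ => 0)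
      (fun b => q b) (fun n => measurable_from_top)
      (fun n => Eventually.of_forall fun b => by
        simpa using mul_le_mul_right (iterate_tabooStep_le_one (A := A) hp hg n b) (q b))
      (by
        rw [lintegral_count]
        exact ne_top_of_le_ne_top hq1
          (ENNReal.tsum_comp_le_tsum_of_injective Subtype.val_injective _))
      (Eventually.of_forall fun b => by
        have h1 : Tendsto (fun n => (tabooStep p A)^[n] g b) atTop (𝓝 0) :=
          ENNReal.tendsto_atTop_zero_of_tsum_ne_top
            (ne_top_of_le_ne_top (hfin b) (green_mono hg b.1))
        simpa using ENNReal.Tendsto.const_mul (a := q b) h1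
          (Or.inr (ENNReal.ne_top_of_tsum_ne_top hq1 _)))
    simpa [lintegral_count] using this
  rw [sum_mul_green, ← sum_mem_add_tsum_notMem A]
  congr 1
  have h1 := ENNReal.summable.hasSum.tendsto_sum_nat
    (f := fun k : ℕ => ∑ a : {a // a ∈ A}, q a * (tabooStep p A)^[k + 1] g a)
  have h2 := h1.add hlim
  simp only [sum_range_iterate_tabooStep_add hq, add_zero] at h2
  exact tendsto_nhds_unique h2 tendsto_const_nhds |>.symm ▸ rfl

theorem green_one_ne_top_of_step {x y : E} (hxy : p x y ≠ 0)
    (hA : ∀ a ∈ A, green p A 1 a ≠ ∞) (hx : green p A 1 x ≠ ∞) : green p A 1 y ≠ ∞ := by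
  by_cases hy : y ∈ A
  · exact hA y hy
  · rw [green_eq] at hx
    have h1 := ENNReal.ne_top_of_tsum_ne_top (ENNReal.add_ne_top.1 hx).2 ⟨y, hy⟩
    intro h
    rw [h, ENNReal.mul_top hxy] at h1
    exact h1 rfl

include hp in
/-- The mean hitting time of `A` is at most that of `{i}` plus the one of `A` started in `i`. -/
theorem green_one_le_add (i x : E) : green p A 1 x ≤ green p {i} 1 x + green p A 1 i := by
  -- Truncating time permits an induction without any finiteness. If the next state is `i`, the
  -- remaining sum is at most the full potential at `i`; otherwise the induction hypothesis applies
  -- there.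
  have key : ∀ (n : ℕ) (x : E), ∑ k ∈ Finset.range n, (tabooStep p A)^[k] 1 x ≤
      green p {i} 1 x + green p A 1 i := by
    intro n
    induction n with
    | zero => simp
    | succ n ih =>
      intro x
      classical
      rw [Finset.sum_range_succ', green_eq (A := {i}) x]
      have hstep : ∑ k ∈ Finset.range n, (tabooStep p A)^[k + 1] 1 x =
          ∑' b : {b // b ∉ A}, p x b * ∑ k ∈ Finset.range n, (tabooStep p A)^[k] 1 b := by
        simp only [Function.iterate_succ_apply', tabooStep, Finset.mul_sum]
        rw [Summable.tsum_finsetSum fun _ _ => ENNReal.summable]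
      have hbound : ∑' b : {b // b ∉ A}, p x b *
            ∑ k ∈ Finset.range n, (tabooStep p A)^[k] 1 b ≤
          ∑' b : {b // b ∉ ({i} : Finset E)}, p x b * green p {i} 1 b + green p A 1 i := by
        calc ∑' b : {b // b ∉ A}, p x b * ∑ k ∈ Finset.range n, (tabooStep p A)^[k] 1 b
            ≤ ∑' b : E, p x b * ∑ k ∈ Finset.range n, (tabooStep p A)^[k] 1 b :=
              ENNReal.tsum_comp_le_tsum_of_injective Subtype.val_injective
                fun b => p x b * ∑ k ∈ Finset.range n, (tabooStep p A)^[k] 1 b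
          _ = ∑ a : {a // a ∈ ({i} : Finset E)},
                p x a * ∑ k ∈ Finset.range n, (tabooStep p A)^[k] 1 a +
              ∑' b : {b // b ∉ ({i} : Finset E)},
                p x b * ∑ k ∈ Finset.range n, (tabooStep p A)^[k] 1 b :=
              (sum_mem_add_tsum_notMem _ _).symm
          _ ≤ ∑ a : {a // a ∈ ({i} : Finset E)}, p x a * green p A 1 i +
              ∑' b : {b // b ∉ ({i} : Finset E)},
                p x b * (green p {i} 1 b + green p A 1 i) := by
              gcongr with a _ b
              · obtain ⟨a, ha⟩ := a
                obtain rfl := Finset.mem_singleton.1 ha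
                exact ENNReal.sum_le_tsum _
              · exact ih b
          _ = ∑' b : {b // b ∉ ({i} : Finset E)}, p x b * green p {i} 1 b +
              (∑ a : {a // a ∈ ({i} : Finset E)}, p x a +
                ∑' b : {b // b ∉ ({i} : Finset E)}, p x b) * green p A 1 i := by
              simp only [mul_add, ENNReal.tsum_add, add_mul, Finset.sum_mul,
                ENNReal.tsum_mul_right]
              ring
          _ = _ := by rw [sum_mem_add_tsum_notMem, hp, one_mul]
      rw [hstep, add_comm, add_assoc]
      exact add_le_add le_rfl hbound
  exact ENNReal.tsum_le_of_sum_range_le fun n => key n x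

end Taboo

/-! ### Finiteness, and the blocks of the theorem as real-valued potentials. -/

section Link

variable {E : Type*}

theorem induction_of_isIrreducible {P : Matrix E E ℝ} (hirr : P.IsIrreducible) {Q : E → Prop}
    (hQ : ∀ x y, 0 < P x y → Q x → Q y) {a : E} (ha : Q a) (y : E) : Q y := by
  let _ : Quiver E := Matrix.toQuiver P
  obtain ⟨w, -⟩ := hirr.connected a y
  induction w with
  | nil => exact ha
  | cons w e ih => exact hQ _ _ e.down ih

/-- The entries of `P` as extended nonnegative reals. -/
def ennKernel (P : Matrix E E ℝ) : E → E → ℝ≥0∞ := fun i j => ENNReal.ofReal (P i j)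

variable {P : Matrix E E ℝ} {π : E → ℝ} {A : Finset E} {g : E → ℝ≥0∞}

theorem tsum_ofReal_of_hasSum {ι : Type*} {f : ι → ℝ} {c : ℝ} (hf : ∀ i, 0 ≤ f i)
    (h : HasSum f c) : ∑' i, ENNReal.ofReal (f i) = ENNReal.ofReal c := by
  rw [← h.tsum_eq, ENNReal.ofReal_tsum_of_nonneg hf h.summable]

theorem IsStochastic.tsum_ennKernel (hP : IsStochastic P) (x : E) :
    ∑' y, ennKernel P x y = 1 := by
  simpa [ennKernel] using tsum_ofReal_of_hasSum (hP.nonneg x) (hP.hasSum_row x)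

theorem IsStochastic.toReal_ennKernel (hP : IsStochastic P) (x y : E) :
    (ennKernel P x y).toReal = P x y := ENNReal.toReal_ofReal (hP.nonneg x y)

theorem IsStochastic.ennKernel_le_one (hP : IsStochastic P) (x y : E) : ennKernel P x y ≤ 1 :=
  hP.tsum_ennKernel x ▸ ENNReal.le_tsum y

theorem IsInvariantProb.tsum_ofReal (hπ : IsInvariantProb P π) :
    ∑' i, ENNReal.ofReal (π i) = 1 := by
  simpa using tsum_ofReal_of_hasSum hπ.nonneg hπ.hasSum_one

theorem IsInvariantProb.tsum_ofReal_mul (hπ : IsInvariantProb P π) (hP : IsStochastic P) (j : E) :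
    ∑' i, ENNReal.ofReal (π i) * ennKernel P i j = ENNReal.ofReal (π j) := by
  rw [← tsum_ofReal_of_hasSum (fun i => mul_nonneg (hπ.nonneg i) (hP.nonneg i j)) (hπ.invariant j)]
  exact tsum_congr fun i => (ENNReal.ofReal_mul (hπ.nonneg i)).symm

theorem IsInvariantProb.pos (hπ : IsInvariantProb P π) (hP : IsStochastic P)
    (hirr : P.IsIrreducible) (i : E) : 0 < π i := by
  obtain ⟨a, ha⟩ : ∃ a, 0 < π a := by
    by_contra! h
    have : π = 0 := funext fun i => le_antisymm (h i) (hπ.nonneg i)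
    have h1 := hπ.hasSum_one
    rw [this] at h1
    exact zero_ne_one (hasSum_zero.unique h1)
  refine induction_of_isIrreducible hirr (Q := fun x => 0 < π x) (fun x y hxy hx => ?_) ha i
  exact (mul_pos hx hxy).trans_le
    (le_hasSum (hπ.invariant y) x fun k _ => mul_nonneg (hπ.nonneg k) (hP.nonneg k y))

variable (hP : IsStochastic P) (hirr : P.IsIrreducible) (hπ : IsInvariantProb P π)
  (hA : A.Nonempty)

-- On `A`, `∑ π(a) E_a[τ_A] ≤ 1` with `π(a) > 0` forces finiteness; one-step transitions then
-- propagate it to all of `E` by irreducibility.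
include hP hirr hπ hA in
theorem green_one_ne_top (x : E) : green (ennKernel P) A 1 x ≠ ∞ := by
  have hmem : ∀ a ∈ A, green (ennKernel P) A 1 a ≠ ∞ := by
    intro a ha h
    have h1 := sum_mul_green_le (A := A) (g := 1) (hπ.tsum_ofReal_mul hP)
    simp only [Pi.one_apply, mul_one, hπ.tsum_ofReal] at h1
    have h2 := (Finset.single_le_sum (fun _ _ => zero_le) (Finset.mem_univ ⟨a, ha⟩)).trans h1
    rw [h, ENNReal.mul_top (by simpa using hπ.pos hP hirr a)] at h2
    simp at h2
  obtain ⟨a, ha⟩ := hA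
  exact induction_of_isIrreducible hirr (Q := fun x => green (ennKernel P) A 1 x ≠ ∞)
    (fun x y hxy hx => green_one_ne_top_of_step (by simpa [ennKernel] using hxy) hmem hx)
    (hmem a ha) x

variable (hfin : ∀ x, green (ennKernel P) A 1 x ≠ ∞)

include hfin in
theorem green_ne_top (hg : g ≤ 1) (x : E) : green (ennKernel P) A g x ≠ ∞ :=
  ne_top_of_le_ne_top (hfin x) (green_mono hg x)

theorem hasSum_toReal_mul {ι : Type*} {f g : ι → ℝ≥0∞} (h : ∑' i, f i * g i ≠ ∞) :
    HasSum (fun i => (f i).toReal * (g i).toReal) (∑' i, f i * g i).toReal := by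
  have h1 := ENNReal.hasSum_toReal h
  rw [← ENNReal.tsum_toReal_eq fun i => ENNReal.ne_top_of_tsum_ne_top h i] at h1
  simpa using h1

include hP hfin in
theorem hasSum_mul_green (hg : g ≤ 1) (x : E) :
    HasSum (fun b : {b // b ∉ A} => P x b * (green (ennKernel P) A g b).toReal)
      ((green (ennKernel P) A g x).toReal - (g x).toReal) := by
  have h := green_ne_top hfin hg x
  have hgx : g x ≠ ∞ := ne_top_of_le_ne_top ENNReal.one_ne_top (hg x)
  rw [green_eq] at h ⊢
  have h2 := (ENNReal.add_ne_top.1 h).2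
  have h3 := hasSum_toReal_mul h2
  rw [ENNReal.toReal_add hgx h2, add_sub_cancel_left]
  simpa only [hP.toReal_ennKernel] using h3

variable [DecidableEq E]

theorem single_le_one (j : E) : (Pi.single j 1 : E → ℝ≥0∞) ≤ 1 := fun x => by
  by_cases h : x = j
  · subst h; simp
  · simp [h]

/-- Mean number of visits to `j` before the chain started in `x` enters `A`. -/
def occupation (P : Matrix E E ℝ) (A : Finset E) (x j : E) : ℝ :=
  (green (ennKernel P) A (Pi.single j 1) x).toReal

omit [DecidableEq E] in
/-- Probability that the chain started in `x` returns to `A` in `a`. -/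
def returnProb (P : Matrix E E ℝ) (A : Finset E) (x a : E) : ℝ :=
  (green (ennKernel P) A (fun y => ennKernel P y a) x).toReal

omit [DecidableEq E] in
/-- Mean return time to `A` of the chain started in `x`. -/
def meanReturn (P : Matrix E E ℝ) (A : Finset E) (x : E) : ℝ :=
  (green (ennKernel P) A 1 x).toReal

include hP hfin in
theorem hasSum_mul_occupation (x j : E) :
    HasSum (fun b : {b // b ∉ A} => P x b * occupation P A b j)
      (occupation P A x j - if x = j then 1 else 0) := by
  have := hasSum_mul_green hP hfin (single_le_one j) x
  rw [Pi.single_apply] at this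
  simp only [apply_ite ENNReal.toReal, ENNReal.toReal_one, ENNReal.toReal_zero] at this
  exact this

include hP hfin in
omit [DecidableEq E] in
theorem hasSum_mul_returnProb (x a : E) :
    HasSum (fun b : {b // b ∉ A} => P x b * returnProb P A b a) (returnProb P A x a - P x a) := by
  rw [← hP.toReal_ennKernel x a]
  exact hasSum_mul_green hP hfin (fun y => hP.ennKernel_le_one y a) x

include hP hfin in
omit [DecidableEq E] in
theorem hasSum_mul_meanReturn (x : E) :
    HasSum (fun b : {b // b ∉ A} => P x b * meanReturn P A b) (meanReturn P A x - 1) := by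
  simpa [meanReturn] using hasSum_mul_green hP hfin (le_refl 1) x

include hP hfin in
omit [DecidableEq E] in
theorem sum_returnProb (x : E) : ∑ a : {a // a ∈ A}, returnProb P A x a = 1 := by
  have h := green_hitting_eq_one hP.tsum_ennKernel (hfin x)
  rw [green_sum] at h
  simp only [returnProb]
  rw [← ENNReal.toReal_sum (f := fun a : {a // a ∈ A} =>
    green (ennKernel P) A (fun y => ennKernel P y a) x)
    fun a _ => green_ne_top hfin (fun y => hP.ennKernel_le_one y a) x, h, ENNReal.toReal_one]

include hfin in
theorem hasSum_occupation_mul (hg : g ≤ 1) (x : {b // b ∉ A}) :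
    HasSum (fun j : {b // b ∉ A} => occupation P A x j * (g j).toReal)
      (green (ennKernel P) A g x).toReal := by
  have h := green_ne_top hfin hg x
  rw [green_apply_eq_tsum] at h ⊢
  exact hasSum_toReal_mul h

include hfin in
theorem hasSum_occupation_mul_of_mem (hg : g ≤ 1) {x : E} (hx : x ∈ A) :
    HasSum (fun j : {b // b ∉ A} => occupation P A x j * (g j).toReal)
      ((green (ennKernel P) A g x).toReal - (g x).toReal) := by
  have h := green_ne_top hfin hg x
  have hgx : g x ≠ ∞ := ne_top_of_le_ne_top ENNReal.one_ne_top (hg x)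
  rw [green_apply_eq_add_tsum hx] at h ⊢
  have h2 := (ENNReal.add_ne_top.1 h).2
  rw [ENNReal.toReal_add hgx h2, add_sub_cancel_left]
  exact hasSum_toReal_mul h2

include hP in
theorem infPow_blockBB (k : ℕ) (i j : {b // b ∉ A}) : infPow (blockBB P A) k i j =
    ((tabooStep (ennKernel P) A)^[k] (Pi.single j.1 1) i).toReal := by
  induction k generalizing i with
  | zero =>
    by_cases h : i = j
    · subst h; simp [infPow]
    · have : i.1 ≠ j.1 := fun h' => h (Subtype.ext h')
      simp [infPow, h, this]
  | succ k ih =>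
    have h := iterate_tabooStep_le_one (A := A) hP.tsum_ennKernel (single_le_one j.1) (k + 1) i
    rw [Function.iterate_succ_apply'] at h ⊢
    have h3 := hasSum_toReal_mul (ne_top_of_le_ne_top ENNReal.one_ne_top h)
    simp only [hP.toReal_ennKernel, ← ih] at h3
    exact h3.tsum_eq

include hP hfin in
theorem hatBB_hasSum (i j : {b // b ∉ A}) :
    HasSum (fun k => infPow (blockBB P A) k i j) (occupation P A i j) := by
  simp only [infPow_blockBB hP]
  have h := green_ne_top hfin (single_le_one j.1) i
  have h1 := ENNReal.hasSum_toReal h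
  rwa [← ENNReal.tsum_toReal_eq fun i => ENNReal.ne_top_of_tsum_ne_top h i] at h1

include hP hfin in
theorem hatBB_apply (i j : {b // b ∉ A}) : hatBB P A i j = occupation P A i j :=
  (hatBB_hasSum hP hfin i j).tsum_eq

include hP hfin in
theorem hasSum_blockABhat (i : {a // a ∈ A}) (j : {b // b ∉ A}) :
    HasSum (fun k => blockAB P A i k * hatBB P A k j) (occupation P A i j) := by
  have hij : i.1 ≠ j.1 := fun h => j.2 (h ▸ i.2)
  have h := hasSum_mul_occupation hP hfin i.1 j.1
  simp only [hij, if_false, sub_zero] at h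
  simp only [hatBB_apply hP hfin]
  exact h

include hP hfin in
theorem blockABhat_apply (i : {a // a ∈ A}) (j : {b // b ∉ A}) :
    blockABhat P A i j = occupation P A i j :=
  (hasSum_blockABhat hP hfin i j).tsum_eq

include hP hfin in
theorem hasSum_hatBlockBA (i : {b // b ∉ A}) (a : {a // a ∈ A}) :
    HasSum (fun k => hatBB P A i k * blockBA P A k a) (returnProb P A i a) := by
  have h := hasSum_occupation_mul hfin (fun y => hP.ennKernel_le_one y a) i
  simp only [hP.toReal_ennKernel] at h
  simp only [hatBB_apply hP hfin]
  exact h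

include hP hfin in
theorem hatBlockBA_apply (i : {b // b ∉ A}) (a : {a // a ∈ A}) :
    hatBlockBA P A i a = returnProb P A i a :=
  (hasSum_hatBlockBA hP hfin i a).tsum_eq

include hP hfin in
theorem hasSum_blockABhat_mul_blockBA (i a : {a // a ∈ A}) :
    HasSum (fun k => blockABhat P A i k * blockBA P A k a) (returnProb P A i a - P i a) := by
  have h := hasSum_occupation_mul_of_mem hfin (fun y => hP.ennKernel_le_one y a) i.2
  simp only [hP.toReal_ennKernel] at h
  simp only [blockABhat_apply hP hfin]
  exact h

include hP hfin in
theorem censored_apply (i a : {a // a ∈ A}) : censored P A i a = returnProb P A i a := by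
  have h := (hasSum_blockABhat_mul_blockBA hP hfin i a).tsum_eq
  simp only [censored, Matrix.add_apply, infMul, Matrix.of_apply, h]
  simp [blockAA]

include hP hfin in
theorem hasSum_hatBB_one (i : {b // b ∉ A}) :
    HasSum (fun k => hatBB P A i k * (1 : {b // b ∉ A} → ℝ) k) (meanReturn P A i) := by
  simpa [hatBB_apply hP hfin, meanReturn] using hasSum_occupation_mul hfin (le_refl 1) i

include hP hfin in
theorem hasSum_blockABhat_one (i : {a // a ∈ A}) :
    HasSum (fun k => blockABhat P A i k * (1 : {b // b ∉ A} → ℝ) k) (meanReturn P A i - 1) := by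
  simpa [blockABhat_apply hP hfin, meanReturn] using hasSum_occupation_mul_of_mem hfin (le_refl 1) i.2

include hP hfin in
theorem blocksConverge : BlocksConverge P A where
  pow k i j := by
    have h := iterate_tabooStep_le_one (A := A) hP.tsum_ennKernel (single_le_one j.1) (k + 1) i
    rw [Function.iterate_succ_apply'] at h
    have h3 := hasSum_toReal_mul (ne_top_of_le_ne_top ENNReal.one_ne_top h)
    simp only [hP.toReal_ennKernel, ← infPow_blockBB hP] at h3
    exact h3.summable
  hat i j := (hatBB_hasSum hP hfin i j).summable
  AB_hat i j := (hasSum_blockABhat hP hfin i j).summable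
  hat_BA i j := (hasSum_hatBlockBA hP hfin i j).summable
  AB_hat_BA i j := (hasSum_blockABhat_mul_blockBA hP hfin i j).summable
  hat_one i := (hasSum_hatBB_one hP hfin i).summable
  AB_hat_one i := (hasSum_blockABhat_one hP hfin i).summable

end Link

/-! ### Group inverse of a matrix with one-dimensional kernel. -/

section GroupInverse

variable {m : Type*} [Fintype m]

/-- A singular matrix with one-dimensional kernel spanned by `1` and a left null vector `ν` with
`ν ⬝ 1 = 1` has a group inverse, which is an inverse off the spectral projection `1 νᵀ`. -/
theorem exists_isGroupInverse_of_ker [DecidableEq m] {W : Matrix m m ℝ} {ν : m → ℝ}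
    (hW : W *ᵥ 1 = 0) (hν : ν ᵥ* W = 0) (hν1 : ν ⬝ᵥ 1 = 1)
    (hker : ∀ x : m → ℝ, W *ᵥ x = 0 → ∃ c : ℝ, x = c • 1) :
    ∃ G, IsGroupInverse W G ∧ W * G = 1 - vecMulVec 1 ν := by
  set J : Matrix m m ℝ := vecMulVec 1 ν with hJ
  have hWJ : W * J = 0 := by rw [hJ, mul_vecMulVec, hW, zero_vecMulVec]
  have hJW : J * W = 0 := by rw [hJ, vecMulVec_mul, hν, vecMulVec_zero]
  have hJJ : J * J = J := by
    rw [hJ, vecMulVec_mul_vecMulVec, hν1, one_smul]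
  -- `J` is a projection with `J W = W J = 0`, so applying `J` to `(W + J) x = 0` separates the two
  -- parts. The group inverse will be `(W + J)⁻¹ - J`.
  have hinj : Function.Injective (W + J).mulVec := by
    rw [← Matrix.coe_mulVecLin, ← LinearMap.ker_eq_bot, LinearMap.ker_eq_bot']
    intro x hx
    rw [Matrix.mulVecLin_apply] at hx
    have h1 : J *ᵥ x = 0 := by
      have := congrArg (fun v => J *ᵥ v) hx
      simpa [Matrix.mul_add, hJW, hJJ] using this
    have h2 : W *ᵥ x = 0 := by rwa [add_mulVec, h1, add_zero] at hx
    obtain ⟨c, rfl⟩ := hker x h2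
    have h3 : J *ᵥ (1 : m → ℝ) = 1 := by
      rw [hJ, vecMulVec_mulVec, hν1]; simp
    rwa [mulVec_smul, h3] at h1
  have hunit : IsUnit (W + J) := Matrix.mulVec_injective_iff_isUnit.1 hinj
  have hdet := (Matrix.isUnit_iff_isUnit_det _).1 hunit
  set Z := (W + J)⁻¹ with hZ
  have hZ1 : (W + J) * Z = 1 := Matrix.mul_nonsing_inv _ hdet
  have hZ2 : Z * (W + J) = 1 := Matrix.nonsing_inv_mul _ hdet
  have hJZ : J * Z = J := by
    have : J * (W + J) = J := by rw [Matrix.mul_add, hJW, hJJ, zero_add]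
    calc J * Z = J * (W + J) * Z := by rw [this]
      _ = J := by rw [Matrix.mul_assoc, hZ1, Matrix.mul_one]
  have hZJ : Z * J = J := by
    have : (W + J) * J = J := by rw [Matrix.add_mul, hWJ, hJJ, zero_add]
    calc Z * J = Z * ((W + J) * J) := by rw [this]
      _ = J := by rw [← Matrix.mul_assoc, hZ2, Matrix.one_mul]
  have hWG : W * (Z - J) = 1 - J := by
    rw [Matrix.add_mul, hJZ] at hZ1
    rw [Matrix.mul_sub, hWJ, sub_zero, ← hZ1, add_sub_cancel_right]
  have hGW : (Z - J) * W = 1 - J := by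
    rw [Matrix.mul_add, hZJ] at hZ2
    rw [Matrix.sub_mul, hJW, sub_zero, ← hZ2, add_sub_cancel_right]
  refine ⟨Z - J, ⟨?_, ?_, hGW.trans hWG.symm⟩, hWG⟩
  · rw [hWG, Matrix.sub_mul, hJW, sub_zero, Matrix.one_mul]
  · rw [hGW, Matrix.sub_mul, Matrix.one_mul, Matrix.mul_sub, hJZ, hJJ, sub_self, sub_zero]

theorem IsGroupInverse.groupInverse {W G : Matrix m m ℝ} (h : IsGroupInverse W G) :
    IsGroupInverse W (groupInverse W) := by
  have hex : ∃ G, IsGroupInverse W G := ⟨G, h⟩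
  rw [PoissonMC.groupInverse, dif_pos hex]
  exact hex.choose_spec

end GroupInverse

/-! ### The censored chain and the solution of Poisson's equation. -/

section Poisson

variable {E : Type*} {P : Matrix E E ℝ} {π : E → ℝ} {A : Finset E}

theorem hasSum_sum_mem_add {f : E → ℝ} {c : ℝ}
    (h : HasSum (fun b : {b // b ∉ A} => f b) c) :
    HasSum f (∑ a : {a // a ∈ A}, f a + c) :=
  HasSum.add_compl (s := (A : Set E)) (hasSum_fintype fun a : {a // a ∈ A} => f a) h

/-- Maximum principle: at a maximum, the nonnegative defects `h a - h y` average to zero, so the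
maximum spreads along transitions. -/
theorem eq_of_forall_le_of_harmonic (hP : IsStochastic P) (hirr : P.IsIrreducible) {h : E → ℝ}
    (hh : ∀ x, HasSum (fun y => P x y * h y) (h x)) {a : E} (ha : ∀ x, h x ≤ h a) (y : E) :
    h y = h a := by
  refine induction_of_isIrreducible hirr (Q := fun x => h x = h a) (fun x y hxy hx => ?_) rfl y
  have h1 : HasSum (fun y => P x y * (h a - h y)) 0 := by
    have := ((hP.hasSum_row x).mul_right (h a)).sub (hh x)
    simpa [mul_sub, hx] using this
  have h2 := (hasSum_zero_iff_of_nonneg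
    fun y => mul_nonneg (hP.nonneg x y) (sub_nonneg.2 (ha y))).1 h1
  have h3 := (mul_eq_zero.1 (congrFun h2 y)).resolve_left hxy.ne'
  linarith

variable (hP : IsStochastic P) (hirr : P.IsIrreducible) (hπ : IsInvariantProb P π)
  (hA : A.Nonempty) (hfin : ∀ x, green (ennKernel P) A 1 x ≠ ∞)

include hP hfin in
theorem hasSum_mul_sum_returnProb (x : E) (v : {a // a ∈ A} → ℝ) :
    HasSum (fun b : {b // b ∉ A} => P x b * ∑ a : {a // a ∈ A}, returnProb P A b a * v a)
      (∑ a : {a // a ∈ A}, (returnProb P A x a - P x a) * v a) := by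
  simp only [Finset.mul_sum, ← mul_assoc]
  exact hasSum_sum fun a _ => (hasSum_mul_returnProb hP hfin x a).mul_right (v a)

-- Extend `v` to `E` by its mean at the return to `A`. The extension is harmonic and, being an
-- average of `v`, attains its maximum on the finite set `A`; the maximum principle makes it
-- constant.
include hP hirr hA hfin in
theorem exists_eq_smul_one_of_censored [DecidableEq E] {v : {a // a ∈ A} → ℝ}
    (hv : (1 - censored P A) *ᵥ v = 0) : ∃ c : ℝ, v = c • 1 := by
  set h : E → ℝ := fun x => ∑ a : {a // a ∈ A}, returnProb P A x a * v a with hdef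
  have hmem : ∀ a : {a // a ∈ A}, h a = v a := by
    intro a
    have h1 := congrFun hv a
    rw [sub_mulVec, one_mulVec, Pi.sub_apply, Pi.zero_apply, sub_eq_zero] at h1
    rw [h1, hdef]
    simp [Matrix.mulVec, dotProduct, censored_apply hP hfin]
  have hh : ∀ x, HasSum (fun y => P x y * h y) (h x) := by
    intro x
    have h1 := hasSum_sum_mem_add (f := fun y => P x y * h y)
      (hasSum_mul_sum_returnProb hP hfin x v)
    convert h1 using 1
    simp only [hmem]
    rw [← Finset.sum_add_distrib, hdef]
    exact Finset.sum_congr rfl fun a _ => by ring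
  obtain ⟨a, -, ha⟩ := Finset.exists_max_image (Finset.univ : Finset {a // a ∈ A}) v
    ⟨⟨hA.choose, hA.choose_spec⟩, Finset.mem_univ _⟩
  have hle : ∀ x, h x ≤ h a := by
    intro x
    rw [hmem]
    calc h x ≤ ∑ b : {b // b ∈ A}, returnProb P A x b * v a :=
          Finset.sum_le_sum fun b hb =>
            mul_le_mul_of_nonneg_left (ha b hb) ENNReal.toReal_nonneg
      _ = v a := by rw [← Finset.sum_mul, sum_returnProb hP hfin, one_mul]
  refine ⟨v a, funext fun b => ?_⟩
  have := eq_of_forall_le_of_harmonic hP hirr hh hle b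
  rw [hmem, hmem] at this
  simpa using this

include hP hπ hfin in
theorem sum_mul_toReal_green {g : E → ℝ≥0∞} (hg : g ≤ 1) :
    ∑ a : {a // a ∈ A}, π a * (green (ennKernel P) A g a).toReal =
      (∑' x, ENNReal.ofReal (π x) * g x).toReal := by
  rw [← sum_mul_green_eq hP.tsum_ennKernel (hπ.tsum_ofReal_mul hP) (by simp [hπ.tsum_ofReal])
    hg hfin, ENNReal.toReal_sum (f := fun a : {a // a ∈ A} =>
      ENNReal.ofReal (π a) * green (ennKernel P) A g a)
      fun a _ => ENNReal.mul_ne_top ENNReal.ofReal_ne_top (green_ne_top hfin hg a)]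
  simp [ENNReal.toReal_ofReal (hπ.nonneg _)]

include hP hπ hfin in
theorem sum_mul_meanReturn : ∑ a : {a // a ∈ A}, π a * meanReturn P A a = 1 := by
  simpa [hπ.tsum_ofReal, meanReturn] using sum_mul_toReal_green hP hπ hfin (le_refl 1)

include hP hπ hfin in
theorem sum_mul_occupation [DecidableEq E] (j : E) :
    ∑ a : {a // a ∈ A}, π a * occupation P A a j = π j := by
  have h := sum_mul_toReal_green hP hπ hfin (single_le_one j)
  rw [tsum_eq_single j fun x hx => by simp [hx]] at h
  simpa [ENNReal.toReal_ofReal (hπ.nonneg _), occupation] using h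

include hP hπ hfin in
theorem sum_mul_returnProb (j : E) :
    ∑ a : {a // a ∈ A}, π a * returnProb P A a j = π j := by
  have h := sum_mul_toReal_green hP hπ hfin (fun y => hP.ennKernel_le_one y j)
  rwa [hπ.tsum_ofReal_mul hP, ENNReal.toReal_ofReal (hπ.nonneg j)] at h

include hP hirr hπ hA hfin in
theorem exists_isGroupInverse_censored [DecidableEq E] :
    ∃ G, IsGroupInverse (1 - censored P A) G ∧ (1 - censored P A) * G =
      1 - vecMulVec 1 (fun a : {a // a ∈ A} => (∑ b : {b // b ∈ A}, π b)⁻¹ * π a) := by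
  have hpos : 0 < ∑ b : {b // b ∈ A}, π b := by
    obtain ⟨a, ha⟩ := hA
    exact Finset.sum_pos (fun b _ => hπ.pos hP hirr b) ⟨⟨a, ha⟩, Finset.mem_univ _⟩
  refine exists_isGroupInverse_of_ker ?_ ?_ ?_
    fun v hv => exists_eq_smul_one_of_censored hP hirr hA hfin hv
  · ext a
    rw [sub_mulVec, one_mulVec]
    simp [Matrix.mulVec, dotProduct, censored_apply hP hfin, sum_returnProb hP hfin,
      -Finset.univ_eq_attach]
  · ext a
    rw [vecMul_sub, vecMul_one]
    simp [vecMul, dotProduct, censored_apply hP hfin, mul_assoc, ← Finset.mul_sum,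
      sum_mul_returnProb hP hπ hfin, -Finset.univ_eq_attach]
  · simp only [dotProduct, Pi.one_apply, mul_one]
    rw [← Finset.mul_sum, inv_mul_cancel₀ hpos.ne']

include hP hirr hπ hA hfin in
theorem isGroupInverse_groupInverse_censored [DecidableEq E] :
    IsGroupInverse (1 - censored P A) (groupInverse (1 - censored P A)) :=
  (exists_isGroupInverse_censored hP hirr hπ hA hfin).choose_spec.1.groupInverse

include hP hirr hπ hA hfin in
theorem one_sub_censored_mul_XtildeA [DecidableEq E] :
    (1 - censored P A) * XtildeA P π A = glueCols A 1 (blockABhat P A) -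
      vecMulVec (1 + infMulVec (blockABhat P A) 1) π := by
  obtain ⟨G, hG, hWG⟩ := exists_isGroupInverse_censored hP hirr hπ hA hfin
  rw [XtildeA, hG.groupInverse.unique hG, ← Matrix.mul_assoc, hWG, Matrix.sub_mul, Matrix.one_mul,
    vecMulVec_mul]
  -- The spectral projection contributes nothing: in column `j` the cycle formula gives `π j` for
  -- the occupation part and `1 * π j` for the mean-return part.
  suffices h : (fun a : {a // a ∈ A} => (∑ b : {b // b ∈ A}, π b)⁻¹ * π a) ᵥ*
      (glueCols A 1 (blockABhat P A) - vecMulVec (1 + infMulVec (blockABhat P A) 1) π) = 0 by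
    rw [h]
    ext
    simp [vecMulVec_apply]
  ext j
  have hmean : ∀ a, (1 + infMulVec (blockABhat P A) 1 : {a // a ∈ A} → ℝ) a =
      meanReturn P A a := by
    intro a
    rw [Pi.add_apply, infMulVec, (hasSum_blockABhat_one hP hfin a).tsum_eq]
    simp
  have hglue : ∑ a : {a // a ∈ A}, π a * glueCols A 1 (blockABhat P A) a j = π j := by
    by_cases hj : j ∈ A
    · simp [glueCols, hj, Matrix.one_apply]
    · simp [glueCols, hj, blockABhat_apply hP hfin, sum_mul_occupation hP hπ hfin,
        -Finset.univ_eq_attach]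
  simp only [vecMul, dotProduct, Matrix.sub_apply, vecMulVec_apply, hmean, mul_assoc,
    ← Finset.mul_sum, mul_sub, Finset.sum_sub_distrib, hglue, Pi.zero_apply]
  simp only [← mul_assoc, ← Finset.sum_mul]
  rw [mul_assoc, sum_mul_meanReturn hP hπ hfin, one_mul, sub_self]

-- On rows in `B` this unfolds the definition; on rows in `A` it is the equation for `(I - P^(A))
-- X̃_A`. One formula for all rows makes first-step analysis uniform.
include hP hirr hπ hA hfin in
theorem Xtilde_apply [DecidableEq E] (x j : E) : Xtilde P π A x j =
    ∑ a : {a // a ∈ A}, returnProb P A x a * XtildeA P π A a j +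
      (if j ∈ A then if x = j then 1 else 0 else occupation P A x j) -
        meanReturn P A x * π j := by
  by_cases hx : x ∈ A
  · have h := congrFun (congrFun (one_sub_censored_mul_XtildeA hP hirr hπ hA hfin) ⟨x, hx⟩) j
    rw [Matrix.sub_mul, Matrix.one_mul] at h
    simp only [Matrix.sub_apply, Matrix.mul_apply, censored_apply hP hfin, vecMulVec_apply,
      Pi.add_apply, infMulVec, (hasSum_blockABhat_one hP hfin _).tsum_eq] at h
    simp only [Xtilde, Matrix.of_apply, hx, dif_pos]
    rw [sub_eq_iff_eq_add] at h
    rw [h]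
    by_cases hj : j ∈ A
    · simp [glueCols, hj, Matrix.one_apply]
      ring
    · simp [glueCols, hj, blockABhat_apply hP hfin]
      ring
  · simp only [Xtilde, Matrix.of_apply, hx, dif_neg, not_false_eq_true, XtildeB, Matrix.sub_apply,
      Matrix.add_apply, Matrix.mul_apply, hatBlockBA_apply hP hfin, vecMulVec_apply, infMulVec,
      (hasSum_hatBB_one hP hfin _).tsum_eq]
    congr 2
    by_cases hj : j ∈ A
    · have : x ≠ j := fun h => hx (h ▸ hj)
      simp [glueCols, hj, this]
    · simp [glueCols, hj, hatBB_apply hP hfin]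

theorem hasSum_one_sub_mul_iff [DecidableEq E] {X : Matrix E E ℝ} {i j : E} {c : ℝ} :
    HasSum (fun k => (1 - P) i k * X k j) (X i j - c) ↔ HasSum (fun k => P i k * X k j) c := by
  have h1 : HasSum (fun k => (1 : Matrix E E ℝ) i k * X k j) (X i j) := by
    have := hasSum_ite_eq i (X i j)
    convert this using 2 with k
    by_cases h : k = i
    · subst h; simp
    · simp [h, Ne.symm h]
  constructor <;> intro h
  · simpa [sub_mul] using h1.sub h
  · simpa [sub_mul] using h1.sub h

theorem isPoissonSolution_iff [DecidableEq E] {X : Matrix E E ℝ} :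
    IsPoissonSolution P π X ↔ ∀ i j, HasSum (fun k => P i k * X k j)
      (X i j - ((if i = j then 1 else 0) - π j)) := by
  have hiff : ∀ i j, HasSum (fun k => P i k * X k j)
      (X i j - ((if i = j then 1 else 0) - π j)) ↔
      HasSum (fun k => (1 - P) i k * X k j) ((if i = j then 1 else 0) - π j) := fun i j => by
    rw [← hasSum_one_sub_mul_iff, sub_sub_cancel]
  simp only [hiff]
  constructor
  · rintro ⟨h1, h2⟩ i j
    have := (h1 i j).hasSum
    have h3 := congrFun (congrFun h2 i) j
    simp only [infMul, Matrix.of_apply] at h3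
    rw [h3] at this
    simpa [Matrix.one_apply, vecMulVec_apply] using this
  · intro h
    refine ⟨fun i j => (h i j).summable, ?_⟩
    ext i j
    rw [infMul, Matrix.of_apply, (h i j).tsum_eq]
    simp [Matrix.one_apply]

include hP hirr hπ hA hfin in
theorem isPoissonSolution_Xtilde [DecidableEq E] : IsPoissonSolution P π (Xtilde P π A) := by
  rw [isPoissonSolution_iff]
  intro x j
  have hrow : ∀ a : {a // a ∈ A}, Xtilde P π A a j = XtildeA P π A a j := fun a => by
    simp [Xtilde]
  have hocc : HasSum (fun b : {b // b ∉ A} => P x b *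
      (if j ∈ A then if b = j then 1 else 0 else occupation P A b j))
      (if j ∈ A then 0 else occupation P A x j - if x = j then 1 else 0) := by
    by_cases hj : j ∈ A
    · have : ∀ b : {b // b ∉ A}, b.1 ≠ j := fun b h => b.2 (h ▸ hj)
      simp [hj, this]
    · simpa only [hj, if_false] using hasSum_mul_occupation hP hfin x j
  have hB := ((hasSum_mul_sum_returnProb hP hfin x fun a => XtildeA P π A a j).add hocc).sub
    ((hasSum_mul_meanReturn hP hfin x).mul_right (π j))
  have hall := hasSum_sum_mem_add (A := A) (f := fun k => P x k * Xtilde P π A k j)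
    (hB.congr_fun fun b => by
      rw [Xtilde_apply hP hirr hπ hA hfin]; ring)
  convert hall using 1
  simp only [hrow]
  rw [Xtilde_apply hP hirr hπ hA hfin]
  simp only [sub_mul, Finset.sum_sub_distrib]
  split_ifs <;> ring

end Poisson

/-! ### Pathwise properties of return times. -/

section ReturnTime

variable {E Ω : Type*} {Φ : ℕ → Ω → E} {S : Set E} {ω : Ω}

theorem lt_returnTime_iff {n : ℕ} :
    (n : ℕ∞) < returnTime Φ S ω ↔ ∀ k, 0 < k → k ≤ n → Φ k ω ∉ S := by
  constructor
  · intro h k hk hkn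
    exact notMem_of_lt_hittingAfter (n := 1)
      (lt_of_le_of_lt (WithTop.coe_le_coe.2 hkn) h) hk
  · intro h
    by_contra! hle
    have hne : hittingAfter Φ S 1 ω ≠ ⊤ := fun htop => by
      rw [returnTime, htop] at hle
      exact absurd hle (not_le.2 (ENat.natCast_lt_top n))
    obtain ⟨m, hm⟩ := WithTop.ne_top_iff_exists.1 hne
    have hmem := hittingAfter_mem_set_of_ne_top hne
    have h1 : ((1 : ℕ) : WithTop ℕ) ≤ hittingAfter Φ S 1 ω := le_hittingAfter ω
    rw [← hm] at hmem h1
    rw [returnTime, ← hm] at hle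
    exact h m (WithTop.coe_le_coe.1 h1) (WithTop.coe_le_coe.1 hle) hmem

theorem exists_returnTime_eq_and_iff {j : E} (hj : j ∈ S) :
    (∃ n : ℕ, returnTime Φ S ω = n ∧ Φ n ω = j) ↔
      ∃ n : ℕ, (∀ k, 0 < k → k ≤ n → Φ k ω ∉ S) ∧ Φ (n + 1) ω = j := by
  constructor
  · rintro ⟨n, hn, hΦ⟩
    have h0 : ((0 : ℕ) : ℕ∞) < returnTime Φ S ω :=
      lt_returnTime_iff.2 fun k hk hk0 => absurd hk0 (not_le.2 hk)
    rw [hn, Nat.cast_lt] at h0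
    obtain ⟨n, rfl⟩ := Nat.exists_eq_succ_of_ne_zero h0.ne'
    refine ⟨n, lt_returnTime_iff.1 ?_, hΦ⟩
    rw [hn]
    exact_mod_cast n.lt_succ_self
  · rintro ⟨n, hn, hΦ⟩
    refine ⟨n + 1, le_antisymm (not_lt.1 fun h => ?_) ?_, hΦ⟩
    · exact lt_returnTime_iff.1 h (n + 1) n.succ_pos le_rfl (hΦ ▸ hj)
    · have := Order.add_one_le_of_lt (lt_returnTime_iff.2 hn)
      exact_mod_cast this

/-- Tail-sum formula; only this direction is needed, to bound potentials by expected return times.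
-/
theorem tsum_indicator_lt_returnTime_le :
    ∑' n : ℕ, {ω | (n : ℕ∞) < returnTime Φ S ω}.indicator (fun _ => (1 : ℝ≥0∞)) ω ≤
      (returnTime Φ S ω : ℝ≥0∞) := by
  induction h : returnTime Φ S ω using ENat.recTopCoe with
  | top => simp
  | coe m =>
    rw [tsum_eq_sum (s := Finset.range m)]
    · refine (Finset.sum_le_sum (g := fun _ => (1 : ℝ≥0∞)) fun n _ => by
        rw [Set.indicator_apply]; split_ifs <;> simp).trans ?_
      simp
    · intro n hn
      refine Set.indicator_of_notMem (fun hlt => hn ?_) _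
      rw [Set.mem_ofPred_eq, h, Nat.cast_lt] at hlt
      exact Finset.mem_range.2 hlt

end ReturnTime

/-! ### Potentials as probabilities and expectations for the chain. -/

section Law

variable {E Ω : Type*} [Countable E] [MeasurableSpace Ω]

theorem measure_inter_preimage_eq_tsum (μ : Measure Ω) {f : Ω → E} (hf : Measurable[_, ⊤] f)
    {S : Set Ω} (hS : MeasurableSet S) {s : Set E} (hs : ∀ ω ∈ S, f ω ∈ s) :
    μ S = ∑' b : s, μ (S ∩ f ⁻¹' {b.1}) := by
  rw [← measure_iUnion]
  · congr 1
    ext ω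
    simp only [Set.mem_iUnion, Set.mem_inter_iff, Set.mem_preimage, Set.mem_singleton_iff]
    exact ⟨fun h => ⟨⟨f ω, hs ω h⟩, h, rfl⟩, fun ⟨_, h, _⟩ => h⟩
  · intro a b hab
    refine Set.disjoint_left.2 fun ω ha hb => hab (Subtype.ext ?_)
    exact ha.2.symm.trans hb.2
  · exact fun b => hS.inter (hf trivial)

variable [DecidableEq E] {P : Matrix E E ℝ} {ℙ : E → Measure Ω} {Φ : ℕ → Ω → E}
  (hΦ : IsMarkovChain P ℙ Φ) (hP : IsStochastic P)

include hΦ in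
omit [Countable E] in
theorem IsMarkovChain.measurableSet_preimage (n : ℕ) (s : Set E) :
    MeasurableSet {ω | Φ n ω ∈ s} :=
  hΦ.measurable n trivial

include hΦ in
omit [Countable E] in
theorem measurableSet_avoid (A : Finset E) (J : Set E) (m n : ℕ) :
    MeasurableSet {ω | (∀ k, m < k → k ≤ n → Φ k ω ∉ A) ∧ Φ (n + 1) ω ∈ J} := by
  have h : MeasurableSet {ω | ∀ k, m < k → k ≤ n → Φ k ω ∉ A} := by
    simp only [Set.ofPred_forall]
    exact .iInter fun k => .iInter fun _ => .iInter fun _ =>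
      hΦ.measurableSet_preimage k {y | y ∉ A}
  exact h.inter (hΦ.measurableSet_preimage _ J)

/-- The chain follows `x` up to time `n`, avoids `A` for the next `m` steps, then jumps to `J`. -/
def tabooEvent (Φ : ℕ → Ω → E) (A : Finset E) (J : Set E) (n m : ℕ) (x : ℕ → E) : Set Ω :=
  {ω | (∀ k ≤ n, Φ k ω = x k) ∧ (∀ k, n < k → k ≤ n + m → Φ k ω ∉ A) ∧ Φ (n + m + 1) ω ∈ J}

include hΦ in
omit [Countable E] in
theorem measurableSet_tabooEvent (A : Finset E) (J : Set E) (n m : ℕ) (x : ℕ → E) :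
    MeasurableSet (tabooEvent Φ A J n m x) := by
  have h1 : MeasurableSet {ω | ∀ k ≤ n, Φ k ω = x k} := by
    simp only [Set.ofPred_forall]
    exact .iInter fun k => .iInter fun _ => hΦ.measurableSet_preimage k {x k}
  exact h1.inter (measurableSet_avoid hΦ A J n (n + m))

include hΦ hP in
omit [Countable E] in
theorem measure_path_update (i : E) (n : ℕ) (x : ℕ → E) (b : E) :
    ℙ i {ω | ∀ k ≤ n + 1, Φ k ω = Function.update x (n + 1) b k} =
      ℙ i {ω | ∀ k ≤ n, Φ k ω = x k} * ennKernel P (x n) b := by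
  rw [hΦ.finite_dim, hΦ.finite_dim, ennKernel, ← ENNReal.ofReal_mul]
  · congr 1
    rw [Finset.prod_range_succ, Function.update_self, Function.update_of_ne (by simp),
      Function.update_of_ne (by simp), mul_assoc]
    congr 2
    refine Finset.prod_congr rfl fun k hk => ?_
    have := Finset.mem_range.1 hk
    rw [Function.update_of_ne (by omega), Function.update_of_ne (by omega)]
  · exact mul_nonneg (by split_ifs <;> simp) (Finset.prod_nonneg fun k _ => hP.nonneg _ _)

omit [Countable E] [DecidableEq E] [MeasurableSpace Ω] in
theorem forall_le_succ_update_iff [DecidableEq E] {n : ℕ} {x : ℕ → E} {b : E} {ω : Ω} :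
    (∀ k ≤ n + 1, Φ k ω = Function.update x (n + 1) b k) ↔
      (∀ k ≤ n, Φ k ω = x k) ∧ Φ (n + 1) ω = b := by
  constructor
  · intro h
    refine ⟨fun k hk => ?_, ?_⟩
    · rw [h k (by omega), Function.update_of_ne (by omega)]
    · rw [h _ le_rfl, Function.update_self]
  · rintro ⟨h1, h2⟩ k hk
    obtain rfl | hk' := eq_or_ne k (n + 1)
    · rw [h2, Function.update_self]
    · rw [Function.update_of_ne hk', h1 k (by omega)]

include hΦ hP in
theorem measure_tabooEvent (i : E) (A : Finset E) (J : Set E) (m n : ℕ) (x : ℕ → E) :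
    ℙ i (tabooEvent Φ A J n m x) = ℙ i {ω | ∀ k ≤ n, Φ k ω = x k} *
      (tabooStep (ennKernel P) A)^[m] (fun y => ∑' j : J, ennKernel P y j) (x n) := by
  -- The next state is absorbed into the prescribed path, so `n` and `x` must vary; only
  -- finite-dimensional laws are used, with no conditioning.
  induction m generalizing n x with
  | zero =>
    rw [measure_inter_preimage_eq_tsum (ℙ i) (hΦ.measurable (n + 1))
      (measurableSet_tabooEvent hΦ A J n 0 x) (s := J) fun ω hω => hω.2.2]
    rw [Function.iterate_zero, id, ← ENNReal.tsum_mul_left]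
    refine tsum_congr fun j => ?_
    rw [← measure_path_update hΦ hP]
    congr 1
    ext ω
    simp only [tabooEvent, Set.mem_inter_iff, Set.mem_ofPred_eq, Set.mem_preimage,
      Set.mem_singleton_iff, forall_le_succ_update_iff]
    constructor
    · rintro ⟨⟨h1, -, -⟩, h2⟩
      exact ⟨h1, h2⟩
    · rintro ⟨h1, h2⟩
      exact ⟨⟨h1, fun k hk hk' => by omega, by simp [h2]⟩, h2⟩
  | succ m ih =>
    rw [measure_inter_preimage_eq_tsum (ℙ i) (hΦ.measurable (n + 1))
      (measurableSet_tabooEvent hΦ A J n (m + 1) x) (s := {y | y ∉ A})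
      fun ω hω => hω.2.1 (n + 1) (by omega) (by omega)]
    rw [Function.iterate_succ_apply', tabooStep, ← ENNReal.tsum_mul_left]
    refine tsum_congr fun b : {b // b ∉ A} => ?_
    have hset : tabooEvent Φ A J n (m + 1) x ∩ Φ (n + 1) ⁻¹' {b.1} =
        tabooEvent Φ A J (n + 1) m (Function.update x (n + 1) b.1) := by
      ext ω
      simp only [tabooEvent, Set.mem_inter_iff, Set.mem_ofPred_eq, Set.mem_preimage,
        Set.mem_singleton_iff, forall_le_succ_update_iff]
      have e : n + (m + 1) = n + 1 + m := by omega
      rw [e]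
      constructor
      · rintro ⟨⟨h1, h2, h3⟩, h4⟩
        exact ⟨⟨h1, h4⟩, fun k hk hk' => h2 k (by omega) hk', h3⟩
      · rintro ⟨⟨h1, h4⟩, h2, h3⟩
        refine ⟨⟨h1, fun k hk hk' => ?_, h3⟩, h4⟩
        obtain rfl | hne := eq_or_ne k (n + 1)
        · rw [h4]; exact b.2
        · exact h2 k (by omega) hk'
    rw [hset, ih, measure_path_update hΦ hP, Function.update_self, mul_assoc]

include hΦ hP in
/-- Law of the position of the chain after `m` steps outside `A`. -/
theorem measure_avoid (i : E) (A : Finset E) (J : Set E) (m : ℕ) :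
    ℙ i {ω | (∀ k, 0 < k → k ≤ m → Φ k ω ∉ A) ∧ Φ (m + 1) ω ∈ J} =
      (tabooStep (ennKernel P) A)^[m] (fun y => ∑' j : J, ennKernel P y j) i := by
  have := hΦ.isProbabilityMeasure i
  have hstart : ℙ i {ω | ∀ k ≤ 0, Φ k ω = i} = 1 := by
    have := hΦ.finite_dim i 0 fun _ => i
    simpa using this
  have h := measure_tabooEvent hΦ hP i A J m 0 fun _ => i
  rw [hstart, one_mul] at h
  rw [← h]
  have hmeas : MeasurableSet {ω | ∀ k ≤ 0, Φ k ω = i} := by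
    simpa using hΦ.measurableSet_preimage 0 {i}
  have hae : ∀ᵐ ω ∂ℙ i, ∀ k ≤ 0, Φ k ω = i := (prob_compl_eq_zero_iff hmeas).2 hstart
  refine measure_congr ?_
  filter_upwards [hae] with ω hω
  refine propext ?_
  simp only [tabooEvent, zero_add]
  exact ⟨fun h => ⟨hω, h⟩, fun h => h.2⟩

include hΦ hP in
theorem measure_returnTime_eq (i : E) (A : Finset E) {j : E} (hj : j ∈ A) :
    ℙ i {ω | ∃ n : ℕ, returnTime Φ A ω = n ∧ Φ n ω = j} =
      green (ennKernel P) A (fun y => ennKernel P y j) i := by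
  have hterm : ∀ n : ℕ, ℙ i {ω | (∀ k, 0 < k → k ≤ n → Φ k ω ∉ A) ∧ Φ (n + 1) ω = j} =
      (tabooStep (ennKernel P) A)^[n] (fun y => ennKernel P y j) i := by
    intro n
    have h := measure_avoid hΦ hP i A {j} n
    simpa using h
  simp only [green, ← hterm]
  rw [← measure_iUnion]
  · congr 1
    ext ω
    simp only [Set.mem_iUnion]
    exact exists_returnTime_eq_and_iff (S := (A : Set E)) hj
  · intro a b hab
    refine Set.disjoint_left.2 fun ω ha hb => hab ?_
    by_contra hne
    rcases lt_or_gt_of_ne hne with hlt | hlt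
    · exact hb.1 (a + 1) a.succ_pos hlt (ha.2 ▸ hj)
    · exact ha.1 (b + 1) b.succ_pos hlt (hb.2 ▸ hj)
  · exact fun n => measurableSet_avoid hΦ A {j} 0 n

include hΦ hP in
theorem green_one_le_expectedReturnTime (i : E) (A : Finset E) :
    green (ennKernel P) A 1 i ≤ expectedReturnTime (ℙ i) Φ A := by
  -- Taking `J` to be all of `E` makes the final jump in `measure_avoid` no constraint.
  have hset : ∀ n : ℕ, {ω | (n : ℕ∞) < returnTime Φ (A : Set E) ω} =
      {ω | (∀ k, 0 < k → k ≤ n → Φ k ω ∉ A) ∧ Φ (n + 1) ω ∈ Set.univ} := by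
    intro n
    ext ω
    simp [lt_returnTime_iff]
  have hmeas : ∀ n : ℕ, MeasurableSet {ω | (n : ℕ∞) < returnTime Φ (A : Set E) ω} := by
    intro n
    rw [hset]
    exact measurableSet_avoid hΦ A Set.univ 0 n
  have hone : (fun y => ∑' j : (Set.univ : Set E), ennKernel P y j) = 1 := by
    ext y
    rw [tsum_univ, hP.tsum_ennKernel, Pi.one_apply]
  calc green (ennKernel P) A 1 i
      = ∑' n : ℕ, ℙ i {ω | (n : ℕ∞) < returnTime Φ (A : Set E) ω} := by
        simp only [hset, measure_avoid hΦ hP, hone, green]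
    _ = ∫⁻ ω, ∑' n : ℕ, {ω | (n : ℕ∞) < returnTime Φ (A : Set E) ω}.indicator
          (fun _ => (1 : ℝ≥0∞)) ω ∂ℙ i := by
        rw [lintegral_tsum fun n => (measurable_const.indicator (hmeas n)).aemeasurable]
        simp [lintegral_indicator_const (hmeas _)]
    _ ≤ expectedReturnTime (ℙ i) Φ A := lintegral_mono fun ω => tsum_indicator_lt_returnTime_le

end Law

/-! ### Integrability and uniqueness. -/

section Uniqueness

variable {E : Type*} {P : Matrix E E ℝ} {π : E → ℝ} {A : Finset E}

theorem ofReal_le_tsum_ofReal {ι : Type*} {f : ι → ℝ} {c : ℝ} (h : HasSum f c) :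
    ENNReal.ofReal c ≤ ∑' i, ENNReal.ofReal (f i) := by
  refine le_of_tendsto ((ENNReal.continuous_ofReal.tendsto c).comp h)
    (Eventually.of_forall fun s => ?_)
  refine le_trans ?_ (ENNReal.sum_le_tsum s)
  exact Finset.le_sum_of_subadditive _ ENNReal.ofReal_zero.le
    (fun _ _ => ENNReal.ofReal_add_le) s f

/-- The positive part `F` of `d - d i` is subharmonic, and `F` and `P F` have the same finite
`π`-integral. As `π > 0`, `F` is harmonic; it vanishes at `i`, hence everywhere by irreducibility.
-/
theorem apply_le_of_harmonic_of_summable (hP : IsStochastic P) (hirr : P.IsIrreducible)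
    (hπ : IsInvariantProb P π) {d : E → ℝ} (hd : ∀ x, HasSum (fun y => P x y * d y) (d x))
    (hsum : Summable fun x => π x * |d x|) (i y : E) : d y ≤ d i := by
  set F : E → ℝ≥0∞ := fun y => ENNReal.ofReal (d y - d i) with hF
  set q : E → ℝ≥0∞ := fun x => ENNReal.ofReal (π x) with hq
  have hsub : ∀ x, F x ≤ ∑' y, ennKernel P x y * F y := by
    intro x
    have h1 := (hd x).sub ((hP.hasSum_row x).mul_right (d i))
    rw [one_mul] at h1
    refine (ofReal_le_tsum_ofReal h1).trans_eq (tsum_congr fun y => ?_)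
    rw [← mul_sub, ENNReal.ofReal_mul (hP.nonneg x y)]
    rfl
  have hmass : ∑' x, q x * ∑' y, ennKernel P x y * F y = ∑' y, q y * F y := by
    simp only [← ENNReal.tsum_mul_left]
    rw [ENNReal.tsum_comm]
    refine tsum_congr fun y => ?_
    simp only [hq]
    rw [← hπ.tsum_ofReal_mul hP y, ← ENNReal.tsum_mul_right]
    simp only [mul_assoc]
  have hfinite : ∑' y, q y * F y ≠ ∞ := by
    have h1 : Summable fun x => π x * |d x| + π x * |d i| :=
      hsum.add (hπ.hasSum_one.summable.mul_right _)
    refine ne_top_of_le_ne_top h1.tsum_ofReal_ne_top (ENNReal.tsum_le_tsum fun x => ?_)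
    rw [hq, hF, ← ENNReal.ofReal_mul (hπ.nonneg x), ← mul_add]
    exact ENNReal.ofReal_le_ofReal
      (mul_le_mul_of_nonneg_left ((le_abs_self _).trans (abs_sub _ _)) (hπ.nonneg x))
  have hle : ∀ x, q x * F x ≤ q x * ∑' y, ennKernel P x y * F y := fun x => by
    gcongr; exact hsub x
  have hdiff : ∑' x, (q x * ∑' y, ennKernel P x y * F y - q x * F x) = 0 := by
    rw [← ENNReal.add_right_inj hfinite, ← ENNReal.tsum_add, add_zero]
    simp only [add_tsub_cancel_of_le (hle _), hmass]
  rw [ENNReal.tsum_eq_zero] at hdiff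
  have hsuper : ∀ x, ∑' y, ennKernel P x y * F y ≤ F x := fun x => by
    have h1 := tsub_eq_zero_iff_le.1 (hdiff x)
    exact (ENNReal.mul_le_mul_iff_right (by simpa [hq] using hπ.pos hP hirr x)
      ENNReal.ofReal_ne_top).1 h1
  have hzero : F y = 0 := by
    refine induction_of_isIrreducible hirr (Q := fun x => F x = 0) (fun x y hxy hx => ?_)
      (show F i = 0 by simp [hF]) y
    have h1 := hsuper x
    rw [hx, nonpos_iff_eq_zero, ENNReal.tsum_eq_zero] at h1
    exact (mul_eq_zero.1 (h1 y)).resolve_left (by simpa [ennKernel] using hxy)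
  rw [hF, ENNReal.ofReal_eq_zero] at hzero
  linarith

variable (hP : IsStochastic P) (hirr : P.IsIrreducible) (hπ : IsInvariantProb P π)
  (hA : A.Nonempty) (hfin : ∀ x, green (ennKernel P) A 1 x ≠ ∞)

theorem expectedReturnTime_lawFrom {Ω : Type*} [MeasurableSpace Ω] (ℙ : E → Measure Ω)
    (π : E → ℝ) (Φ : ℕ → Ω → E) (S : Set E) : expectedReturnTime (lawFrom ℙ π) Φ S =
      ∑' x, ENNReal.ofReal (π x) * expectedReturnTime (ℙ x) Φ S := by
  simp [expectedReturnTime, lawFrom, lintegral_sum_measure, lintegral_smul_measure]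

include hP hπ hfin in
theorem summable_mul_meanReturn [DecidableEq E] [Countable E] {Ω : Type*} [MeasurableSpace Ω]
    {ℙ : E → Measure Ω} {Φ : ℕ → Ω → E} (hΦ : IsMarkovChain P ℙ Φ) {i : E}
    (hi : expectedReturnTime (lawFrom ℙ π) Φ {i} < ∞) :
    Summable fun x => π x * meanReturn P A x := by
  have hbound : ∑' x, ENNReal.ofReal (π x) * green (ennKernel P) A 1 x ≠ ∞ := by
    refine ne_top_of_le_ne_top (b := expectedReturnTime (lawFrom ℙ π) Φ {i} +
      green (ennKernel P) A 1 i) (ENNReal.add_ne_top.2 ⟨hi.ne, hfin i⟩) ?_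
    calc ∑' x, ENNReal.ofReal (π x) * green (ennKernel P) A 1 x
        ≤ ∑' x, ENNReal.ofReal (π x) * (expectedReturnTime (ℙ x) Φ {i} +
            green (ennKernel P) A 1 i) := by
          refine ENNReal.tsum_le_tsum fun x => ?_
          gcongr
          refine (green_one_le_add hP.tsum_ennKernel i x).trans ?_
          gcongr
          simpa using green_one_le_expectedReturnTime hΦ hP x {i}
      _ = _ := by
          simp only [mul_add, ENNReal.tsum_add, ENNReal.tsum_mul_right, hπ.tsum_ofReal, one_mul,
            expectedReturnTime_lawFrom]
  have h := (hasSum_toReal_mul hbound).summable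
  simpa only [ENNReal.toReal_ofReal (hπ.nonneg _), meanReturn] using h

include hP hirr hπ hA hfin in
theorem piAbsFinite_Xtilde [DecidableEq E] (hmean : Summable fun x => π x * meanReturn P A x) :
    PiAbsFinite π (Xtilde P π A) := by
  intro j
  have hmean0 : ∀ x, 0 ≤ meanReturn P A x := fun x => ENNReal.toReal_nonneg
  have hbound : ∀ x, |Xtilde P π A x j| ≤
      (∑ a : {a // a ∈ A}, |XtildeA P π A a j| + 1) + meanReturn P A x * (1 + π j) := by
    intro x
    have hret : |∑ a : {a // a ∈ A}, returnProb P A x a * XtildeA P π A a j| ≤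
        ∑ a : {a // a ∈ A}, |XtildeA P π A a j| := by
      refine (Finset.abs_sum_le_sum_abs _ _).trans (Finset.sum_le_sum fun a ha => ?_)
      have h0 : ∀ b, 0 ≤ returnProb P A x b := fun b => ENNReal.toReal_nonneg
      have h1 : returnProb P A x a ≤ 1 := by
        rw [← sum_returnProb hP hfin x]
        exact Finset.single_le_sum (f := fun a : {a // a ∈ A} => returnProb P A x a)
          (fun b _ => h0 b) ha
      rw [abs_mul, abs_of_nonneg (h0 a)]
      exact mul_le_of_le_one_left (abs_nonneg _) h1
    have hocc : |if j ∈ A then if x = j then 1 else 0 else occupation P A x j| ≤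
        1 + meanReturn P A x := by
      have h2 : occupation P A x j ≤ meanReturn P A x :=
        ENNReal.toReal_mono (hfin x) (green_mono (single_le_one j) x)
      have h3 : 0 ≤ occupation P A x j := ENNReal.toReal_nonneg
      rw [abs_of_nonneg (by split_ifs <;> simp [h3])]
      have := hmean0 x
      split_ifs <;> linarith
    have hlast : |meanReturn P A x * π j| = meanReturn P A x * π j :=
      abs_of_nonneg (mul_nonneg (hmean0 x) (hπ.nonneg j))
    rw [Xtilde_apply hP hirr hπ hA hfin]
    refine (abs_sub _ _).trans ((add_le_add_left (abs_add_le _ _) _).trans ?_)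
    rw [hlast]
    linarith
  refine Summable.of_nonneg_of_le (fun x => mul_nonneg (hπ.nonneg x) (abs_nonneg _))
    (fun x => mul_le_mul_of_nonneg_left (hbound x) (hπ.nonneg x)) ?_
  simp only [mul_add (π _), ← mul_assoc]
  exact (hπ.hasSum_one.summable.mul_right _ |>.add (hπ.hasSum_one.summable.mul_right _) |>.add
    (hmean.mul_right _))

include hP hirr hπ in
/-- Two `π`-integrable solutions of Poisson's equation differ by a matrix `e βᵀ`. -/
theorem isPoissonSolution_and_piAbsFinite_iff [DecidableEq E] {X Y : Matrix E E ℝ}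
    (hY : IsPoissonSolution P π Y) (hYfin : PiAbsFinite π Y) :
    (IsPoissonSolution P π X ∧ PiAbsFinite π X) ↔ ∃ β : E → ℝ, X = Y + vecMulVec 1 β := by
  rw [isPoissonSolution_iff] at *
  constructor
  · rintro ⟨hX, hXfin⟩
    have hle : ∀ i y j, X y j - Y y j ≤ X i j - Y i j := fun i y j => by
      refine apply_le_of_harmonic_of_summable (d := fun y => X y j - Y y j) hP hirr hπ
        (fun x => ?_) ?_ i y
      · have := (hX x j).sub (hY x j)
        rw [sub_sub_sub_cancel_right] at this
        simpa only [mul_sub] using this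
      · refine Summable.of_nonneg_of_le (fun x => mul_nonneg (hπ.nonneg x) (abs_nonneg _))
          (fun x => ?_) ((hXfin j).add (hYfin j))
        rw [← mul_add]
        exact mul_le_mul_of_nonneg_left (abs_sub _ _) (hπ.nonneg x)
    -- Each column of `X - Y` is constant, so any row would serve; the diagonal avoids choosing a
    -- base point.
    refine ⟨fun j => X j j - Y j j, ?_⟩
    ext x j
    have := le_antisymm (hle j x j) (hle x j j)
    simp only [Matrix.add_apply, vecMulVec_apply, Pi.one_apply, one_mul]
    linarith
  · rintro ⟨β, rfl⟩
    refine ⟨fun i j => ?_, fun j => ?_⟩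
    · have := (hY i j).add ((hP.hasSum_row i).mul_right (β j))
      convert this using 1
      · ext k; simp [mul_add]
      · simp; ring
    · refine Summable.of_nonneg_of_le (fun x => mul_nonneg (hπ.nonneg x) (abs_nonneg _))
        (fun x => ?_) ((hYfin j).add (hπ.hasSum_one.summable.mul_right |β j|))
      rw [← mul_add]
      refine mul_le_mul_of_nonneg_left ?_ (hπ.nonneg x)
      simpa [vecMulVec_apply] using abs_add_le (Y x j) (β j)

end Uniqueness

end PoissonMC

end

theorem theorem1 {E Ω : Type*} [Countable E] [DecidableEq E] [MeasurableSpace Ω]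
    (P : Matrix E E ℝ) (ℙ : E → Measure Ω) (Φ : ℕ → Ω → E) (π : E → ℝ)
    (hP : PoissonMC.IsStochastic P) (hΦ : PoissonMC.IsMarkovChain P ℙ Φ)
    (hirr : P.IsIrreducible) (hrec : PoissonMC.PositiveRecurrent ℙ Φ)
    (hπ : PoissonMC.IsInvariantProb P π)
    (A : Finset E) (hA : A.Nonempty) :
    PoissonMC.BlocksConverge P A ∧
    (∀ i j : {i // i ∈ A}, ℙ i {ω | ∃ n : ℕ, PoissonMC.returnTime Φ A ω = n ∧ Φ n ω = j} =
      ENNReal.ofReal (PoissonMC.censored P A i j)) ∧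
    PoissonMC.IsGroupInverse (1 - PoissonMC.censored P A)
      (PoissonMC.groupInverse (1 - PoissonMC.censored P A)) ∧
    PoissonMC.IsPoissonSolution P π (PoissonMC.Xtilde P π A) ∧
    ((∃ i, PoissonMC.expectedReturnTime (PoissonMC.lawFrom ℙ π) Φ {i} < ∞) →
      ∀ X : Matrix E E ℝ,
        (PoissonMC.IsPoissonSolution P π X ∧ PoissonMC.PiAbsFinite π X) ↔
          ∃ β : E → ℝ, X = PoissonMC.Xtilde P π A + vecMulVec 1 β) := by
  have hfin := PoissonMC.green_one_ne_top hP hirr hπ hA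
  have hsol := PoissonMC.isPoissonSolution_Xtilde hP hirr hπ hA hfin
  refine ⟨PoissonMC.blocksConverge hP hfin, fun i j => ?_,
    PoissonMC.isGroupInverse_groupInverse_censored hP hirr hπ hA hfin, hsol, ?_⟩
  · rw [PoissonMC.measure_returnTime_eq hΦ hP i A j.2, PoissonMC.censored_apply hP hfin,
      PoissonMC.returnProb, ENNReal.ofReal_toReal
        (PoissonMC.green_ne_top hfin (fun y => hP.ennKernel_le_one y j) i)]
  · rintro ⟨i, hi⟩ X
    exact PoissonMC.isPoissonSolution_and_piAbsFinite_iff hP hirr hπ hsol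
      (PoissonMC.piAbsFinite_Xtilde hP hirr hπ hA hfin
        (PoissonMC.summable_mul_meanReturn hP hπ hfin hΦ hi))
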